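/- Let $d,D\ge 0$, $n\ge 1$, $T$ be integers and let $B_1,B_2\ge 0$, $R$ be real numbers. A \emph{bag} is a nonempty finite family $\mathbf B=(h_1,\dots,h_{T_{\mathbf B}})$ of instances $h_t\in\mathbb R^d$. Write $a(x)=\max(x,0)$ for the ReLU, applied coordinatewise to vectors, and let $\rho$ denote max pooling, $\rho(u_1,\dots,u_m)_k=\max_{1\le t\le m}u_{t,k}$. For $W\in\mathbb R^{D\times d}$ with rows $W_1,\dots,W_D$ and $w\in\mathbb R^D$ put $$f^{\mathrm{feat}}_{W,w}(\mathbf B)=w^\top\rho\big(a(Wh_1),\dots,a(Wh_{T_{\mathbf B}})\big),\qquad f^{\mathrm{base}}_{W,w}(\mathbf B)=w^\top a\big(W\rho(h_1,\dots,h_{T_{\mathbf B}})\big),$$ and let $\mathcal F_{\mathrm{feat}}$, $\mathcal F_{\mathrm{base}}$ be the classes of all $f^{\mathrm{feat}}_{W,w}$, respectively all $f^{\mathrm{base}}_{W,w}$, with $\|W_j\|_2\le B_1$ for every $j$ and $\|w\|_2\le B_2$. Let $S=(\mathbf B_1,\dots,\mathbf B_n)$ be a sample of bags, where $\mathbf B_i=(h_{i,1},\dots,h_{i,T_i})$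 with $T_i\le T$ and $\|h_{i,t}\|_2\le R$ for all $i,t$. For a class $\mathcal F$ of real functions on bags let $$\hat{\mathcal R}_S(\mathcal F)=\mathbb E_\sigma\Big[\sup_{f\in\mathcal F}\frac1n\sum_{i=1}^n\sigma_i f(\mathbf B_i)\Big]$$ be its empirical Rademacher complexity, where $\sigma_1,\dots,\sigma_n$ are independent and uniform on $\{-1,1\}$. Then for both classes the supremum is finite for every $\sigma\in\{-1,1\}^n$, and $$\hat{\mathcal R}_S(\mathcal F_{\mathrm{feat}})\le 2\sqrt2\,R\,B_1B_2\sqrt{\frac{DT}{n}},\qquad \hat{\mathcal R}_S(\mathcal F_{\mathrm{base}})\le 2R\,B_1B_2\sqrt{\frac{Dd}{n}}.$$ In particular the first bound does not depend on the input dimension $d$. -/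

import Mathlib

open scoped BigOperators

noncomputable section

namespace MaxPoolMIL

/-- A bag: a nonempty finite family of instances (hidden states) in `ℝ^d` with the Euclidean norm.
The number of instances may differ from bag to bag. -/
structure Bag (d : ℕ) where
  /-- The number of instances. -/
  size : ℕ
  size_pos : 0 < size
  /-- The instances. -/
  inst : Fin size → EuclideanSpace ℝ (Fin d)

/-- Apply a map to every instance of a bag. -/
def Bag.map {d D : ℕ} (g : EuclideanSpace ℝ (Fin d) → EuclideanSpace ℝ (Fin D)) (B : Bag d) :
    Bag D where
  size := B.size
  size_pos := B.size_pos
  inst := fun t => g (B.inst t)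

/-- Max pooling: the channelwise maximum over the instances of a bag. -/
def maxPool {d : ℕ} (B : Bag d) : EuclideanSpace ℝ (Fin d) :=
  WithLp.toLp 2 fun k =>
    (Finset.univ : Finset (Fin B.size)).sup' ⟨⟨0, B.size_pos⟩, Finset.mem_univ _⟩
      fun t => B.inst t k

/-- The ReLU activation. -/
def relu (x : ℝ) : ℝ := max x 0

/-- The layer `h ↦ (relu ⟨W_j, h⟩)_j`, for a weight matrix given by its rows `W_1, …, W_D`. -/
def reluLayer {d D : ℕ} (W : Fin D → EuclideanSpace ℝ (Fin d)) (h : EuclideanSpace ℝ (Fin d)) :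
    EuclideanSpace ℝ (Fin D) :=
  WithLp.toLp 2 fun j => relu (inner ℝ (W j) h)

/-- Feature extraction on every instance, then max pooling of the features, then a linear head. -/
def featModel {d D : ℕ} (W : Fin D → EuclideanSpace ℝ (Fin d)) (w : EuclideanSpace ℝ (Fin D))
    (B : Bag d) : ℝ :=
  inner ℝ w (maxPool (B.map (reluLayer W)))

/-- Max pooling in the input space, then the ReLU layer, then a linear head. -/
def baseModel {d D : ℕ} (W : Fin D → EuclideanSpace ℝ (Fin d)) (w : EuclideanSpace ℝ (Fin D))
    (B : Bag d) : ℝ :=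
  inner ℝ w (reluLayer W (maxPool B))

/-- All feature-extraction models with row norms at most `B₁` and head norm at most `B₂`. -/
def featClass (d D : ℕ) (B₁ B₂ : ℝ) : Set (Bag d → ℝ) :=
  {f | ∃ (W : Fin D → EuclideanSpace ℝ (Fin d)) (w : EuclideanSpace ℝ (Fin D)),
    (∀ j, ‖W j‖ ≤ B₁) ∧ ‖w‖ ≤ B₂ ∧ f = featModel W w}

/-- All baseline models with row norms at most `B₁` and head norm at most `B₂`. -/
def baseClass (d D : ℕ) (B₁ B₂ : ℝ) : Set (Bag d → ℝ) :=
  {f | ∃ (W : Fin D → EuclideanSpace ℝ (Fin d)) (w : EuclideanSpace ℝ (Fin D)),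
    (∀ j, ‖W j‖ ≤ B₁) ∧ ‖w‖ ≤ B₂ ∧ f = baseModel W w}

/-- The correlation `(1/n) ∑ i, σ i * f (S i)` of a function with a sign vector on a sample. -/
def signCorrelation {X : Type*} {n : ℕ} (S : Fin n → X) (σ : Fin n → ℤˣ) (f : X → ℝ) : ℝ :=
  (1 / (n : ℝ)) * ∑ i, ((σ i : ℤ) : ℝ) * f (S i)

/-- The supremum in the empirical Rademacher complexity is finite for every sign vector. -/
def RademacherFinite {X : Type*} {n : ℕ} (F : Set (X → ℝ)) (S : Fin n → X) : Prop :=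
  ∀ σ : Fin n → ℤˣ, BddAbove (signCorrelation S σ '' F)

/-- The empirical Rademacher complexity of `F` on the sample `S`: the expectation of
`sup_{f ∈ F} (1/n) ∑ i, σ i * f (S i)` over independent uniform signs, that is, over a uniformly
distributed sign vector `σ ∈ {-1, 1}^n`. (The real `sSup` is the supremum for nonempty `F` with
`RademacherFinite F S`.) -/
def empiricalRademacher {X : Type*} {n : ℕ} (F : Set (X → ℝ)) (S : Fin n → X) : ℝ :=
  𝔼 σ : Fin n → ℤˣ, sSup (signCorrelation S σ '' F)

end MaxPoolMIL

end

open scoped BigOperators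

/-! By Cauchy–Schwarz in the head `w`, the feature class reduces to a single ReLU unit: each
coordinate of the pooled sign sum is controlled by a supremum over one weight vector `v`, at the
cost of a factor `√D`. A pooled ReLU unit is `1`-Lipschitz in the maximum norm of the vector of
responses `⟨v, h_t⟩`. Since `|a s| ≤ 𝔼 |∑ ε_t a_t|`, contraction (`expect_iSup_sum_sign_mul_le`)
replaces one sign per bag by one sign per instance with constant `1`. What remains is linear in `v`,
and orthogonality of the signs bounds it by `B₁ R √(nT)`, with no dependence on `d`. The baseline is
the feature model on singleton bags of pooled instances, so it follows with `T = 1` and radius `√d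
R`. -/

namespace MaxPoolMIL

/-! ### Moments of Rademacher sums -/

section Signs

variable {ι : Type*} [Fintype ι] [DecidableEq ι]

/-- Independent uniform signs are orthonormal. -/
theorem expect_sign_mul_sign (a b : ι) :
    𝔼 ε : ι → ℤˣ, (((ε a : ℤ) : ℝ) * ((ε b : ℤ) : ℝ)) = if a = b then 1 else 0 := by
  split_ifs with hab
  · subst hab
    have h : ∀ ε : ι → ℤˣ, ((ε a : ℤ) : ℝ) * ((ε a : ℤ) : ℝ) = 1 := fun ε => by
      exact_mod_cast Int.units_coe_mul_self (ε a)
    simp_rw [h]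
    exact Fintype.expect_const 1
  · have h : 𝔼 ε : ι → ℤˣ, (((ε a : ℤ) : ℝ) * ((ε b : ℤ) : ℝ)) =
        𝔼 ε : ι → ℤˣ, -(((ε a : ℤ) : ℝ) * ((ε b : ℤ) : ℝ)) := by
      refine Fintype.expect_equiv (Equiv.mulLeft (Pi.mulSingle a (-1))) _ _ fun ε => ?_
      have hb : (Pi.mulSingle a (-1) : ι → ℤˣ) b = 1 :=
        Pi.mulSingle_eq_of_ne (Ne.symm hab) _
      simp [hb]
    rw [Finset.expect_neg_distrib] at h
    linarith

theorem expect_norm_sq_sum_sign_smul {E : Type*} [NormedAddCommGroup E] [InnerProductSpace ℝ E]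
    (h : ι → E) :
    𝔼 ε : ι → ℤˣ, ‖∑ a, ((ε a : ℤ) : ℝ) • h a‖ ^ 2 = ∑ a, ‖h a‖ ^ 2 := by
  have key : ∀ ε : ι → ℤˣ, ‖∑ a, ((ε a : ℤ) : ℝ) • h a‖ ^ 2 =
      ∑ a, ∑ b, (((ε a : ℤ) : ℝ) * ((ε b : ℤ) : ℝ)) * inner ℝ (h a) (h b) := fun ε => by
    rw [← real_inner_self_eq_norm_sq]
    simp only [sum_inner, inner_sum, real_inner_smul_left, real_inner_smul_right, mul_assoc]
    exact Finset.sum_congr rfl fun a _ => Finset.sum_congr rfl fun b _ => by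
      rw [real_inner_comm]
  simp_rw [key, Finset.expect_sum_comm, ← Finset.expect_mul, expect_sign_mul_sign]
  simp

theorem expect_norm_sum_sign_smul_le {E : Type*} [NormedAddCommGroup E] [InnerProductSpace ℝ E]
    (h : ι → E) :
    𝔼 ε : ι → ℤˣ, ‖∑ a, ((ε a : ℤ) : ℝ) • h a‖ ≤ √(∑ a, ‖h a‖ ^ 2) := by
  refine Real.le_sqrt_of_sq_le ?_
  have := Finset.expect_mul_sq_le_sq_mul_sq Finset.univ
    (fun ε : ι → ℤˣ => ‖∑ a, ((ε a : ℤ) : ℝ) • h a‖) (fun _ => (1 : ℝ))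
  simpa [expect_norm_sq_sum_sign_smul] using this

/-- A Rademacher sum is in absolute mean at least as large as each of its coefficients. -/
theorem abs_le_expect_abs_sum_sign_mul (a : ι → ℝ) (s : ι) :
    |a s| ≤ 𝔼 ε : ι → ℤˣ, |∑ t, ((ε t : ℤ) : ℝ) * a t| := by
  -- Orthonormality recovers a coefficient by correlating the sum with its sign.
  have h : a s = 𝔼 ε : ι → ℤˣ, ((ε s : ℤ) : ℝ) * ∑ t, ((ε t : ℤ) : ℝ) * a t := by
    simp_rw [Finset.mul_sum, ← mul_assoc, Finset.expect_sum_comm, ← Finset.expect_mul,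
      expect_sign_mul_sign]
    simp
  calc |a s| = |𝔼 ε : ι → ℤˣ, ((ε s : ℤ) : ℝ) * ∑ t, ((ε t : ℤ) : ℝ) * a t| := by rw [← h]
    _ ≤ 𝔼 ε : ι → ℤˣ, |((ε s : ℤ) : ℝ) * ∑ t, ((ε t : ℤ) : ℝ) * a t| :=
      Finset.abs_expect_le _ _
    _ = _ := by
      refine Finset.expect_congr rfl fun ε _ => ?_
      rw [abs_mul, ← Int.cast_abs, Int.abs_eq_natAbs, Int.units_natAbs]
      simp

theorem expect_sign (f : ℤˣ → ℝ) : 𝔼 s, f s = (f 1 + f (-1)) / 2 := by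
  rw [Fintype.expect_eq_sum_div_card, UnitsInt.univ, Finset.sum_pair (by decide)]
  simp

end Signs

/-! ### Vector contraction in the maximum norm -/

section Contraction

variable {V : Type*} [TopologicalSpace V] [CompactSpace V]

theorem bddAbove_range_of_continuous {f : V → ℝ} (hf : Continuous f) :
    BddAbove (Set.range f) :=
  (isCompact_range hf).bddAbove

variable [Nonempty V]

/-- Comparison for one sign: `φ` is `1`-Lipschitz in the maximum norm of the vector `x`. -/
theorem expect_iSup_sign_mul_le {ι : Type*} [Fintype ι] [DecidableEq ι] {g φ : V → ℝ}
    {x : ι → V → ℝ} (hg : Continuous g) (hx : ∀ t, Continuous (x t))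
    (hL : ∀ v v', ∃ s, |φ v - φ v'| ≤ |x s v - x s v'|) :
    𝔼 s : ℤˣ, ⨆ v, (g v + ((s : ℤ) : ℝ) * φ v) ≤
      𝔼 ε : ι → ℤˣ, ⨆ v, (g v + ∑ t, ((ε t : ℤ) : ℝ) * x t v) := by
  set F : (ι → ℤˣ) → ℝ := fun ε => ⨆ v, (g v + ∑ t, ((ε t : ℤ) : ℝ) * x t v) with hF
  have hle : ∀ ε v, g v + ∑ t, ((ε t : ℤ) : ℝ) * x t v ≤ F ε := fun ε v =>
    le_ciSup (f := fun v => g v + ∑ t, ((ε t : ℤ) : ℝ) * x t v)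
      (bddAbove_range_of_continuous (by fun_prop)) v
  have hneg : 𝔼 ε, F (-ε) = 𝔼 ε, F ε :=
    Fintype.expect_equiv (Equiv.neg _) _ _ fun _ => rfl
  -- The two values of the sign may select different points, so pairs `v`, `v'` are compared, with
  -- `ε` matched to `-ε`.
  have key : ∀ v v', g v + φ v + (g v' - φ v') ≤ 2 * 𝔼 ε, F ε := by
    intro v v'
    obtain ⟨s, hs⟩ := hL v v'
    have h1 := abs_le_expect_abs_sum_sign_mul (fun t => x t v - x t v') s
    have h2 : g v + g v' + 𝔼 ε : ι → ℤˣ, |∑ t, ((ε t : ℤ) : ℝ) * (x t v - x t v')| ≤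
        𝔼 ε, (F ε + F (-ε)) := by
      rw [← Fintype.expect_const (ι := ι → ℤˣ) (g v + g v'), ← Finset.expect_add_distrib]
      refine Finset.expect_le_expect fun ε _ => ?_
      have e1 := hle ε v
      have e2 := hle ε v'
      have e3 := hle (-ε) v
      have e4 := hle (-ε) v'
      simp only [Pi.neg_apply, Units.val_neg, Int.cast_neg, neg_mul, Finset.sum_neg_distrib]
        at e3 e4
      simp only [mul_sub, Finset.sum_sub_distrib]
      -- The sign of the difference decides which of `v`, `v'` is tested against `ε` and which
      -- against `-ε`.
      rcases abs_cases (∑ t, ((ε t : ℤ) : ℝ) * x t v - ∑ t, ((ε t : ℤ) : ℝ) * x t v') with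
        ⟨h, -⟩ | ⟨h, -⟩ <;> rw [h] <;> linarith
    rw [Finset.expect_add_distrib, hneg] at h2
    linarith [le_abs_self (φ v - φ v')]
  rw [expect_sign]
  have : (⨆ v, (g v + φ v)) ≤ 2 * (𝔼 ε, F ε) - ⨆ v, (g v - φ v) :=
    ciSup_le fun v => by
      have : (⨆ v, (g v - φ v)) ≤ 2 * (𝔼 ε, F ε) - (g v + φ v) :=
        ciSup_le fun v' => by linarith [key v v']
      linarith
  simp only [Units.val_one, Int.cast_one, one_mul, Units.val_neg, Int.cast_neg, neg_mul,
    ← sub_eq_add_neg]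
  linarith

theorem expect_fin_succ {n : ℕ} (α : Fin (n + 1) → Type*) [∀ i, Fintype (α i)]
    (f : (∀ i, α i) → ℝ) :
    𝔼 ε, f ε = 𝔼 a : α 0, 𝔼 ε : ∀ i : Fin n, α i.succ, f (Fin.cons a ε) := by
  rw [← Finset.expect_product', Finset.univ_product_univ]
  exact (Fintype.expect_equiv (Fin.consEquiv α) _ _ fun _ => rfl).symm

/-- Vector contraction for Rademacher averages, for maps that are `1`-Lipschitz in the maximum
norm. -/
theorem expect_iSup_sum_sign_mul_le {n : ℕ} {κ : Fin n → Type*} [∀ i, Fintype (κ i)]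
    [∀ i, DecidableEq (κ i)] {g : V → ℝ} {φ : Fin n → V → ℝ} {x : ∀ i, κ i → V → ℝ}
    (hg : Continuous g) (hφ : ∀ i, Continuous (φ i)) (hx : ∀ i t, Continuous (x i t))
    (hL : ∀ i v v', ∃ s, |φ i v - φ i v'| ≤ |x i s v - x i s v'|) :
    𝔼 σ : Fin n → ℤˣ, ⨆ v, (g v + ∑ i, ((σ i : ℤ) : ℝ) * φ i v) ≤
      𝔼 ε : ∀ i, κ i → ℤˣ, ⨆ v, (g v + ∑ i, ∑ t, ((ε i t : ℤ) : ℝ) * x i t v) := by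
  induction n generalizing g with
  | zero => simp
  | succ n ih =>
    rw [expect_fin_succ, expect_fin_succ (fun i => κ i → ℤˣ)]
    simp only [Fin.sum_univ_succ, Fin.cons_zero, Fin.cons_succ, ← add_assoc]
    -- Signs are exchanged one at a time: `g` absorbs the terms held fixed, which is why the
    -- induction generalizes it.
    calc _ ≤ 𝔼 s : ℤˣ, 𝔼 ε : ∀ i : Fin n, κ i.succ → ℤˣ, ⨆ v, (g v + ((s : ℤ) : ℝ) * φ 0 v +
            ∑ i : Fin n, ∑ t, ((ε i t : ℤ) : ℝ) * x i.succ t v) :=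
          Finset.expect_le_expect fun s _ =>
            ih (g := fun v => g v + ((s : ℤ) : ℝ) * φ 0 v) (by fun_prop)
              (fun i => hφ i.succ) (fun i => hx i.succ) (fun i => hL i.succ)
      _ = 𝔼 ε : ∀ i : Fin n, κ i.succ → ℤˣ, 𝔼 s : ℤˣ, ⨆ v, ((g v +
            ∑ i : Fin n, ∑ t, ((ε i t : ℤ) : ℝ) * x i.succ t v) + ((s : ℤ) : ℝ) * φ 0 v) := by
          rw [Finset.expect_comm]
          simp only [add_right_comm]
      _ ≤ 𝔼 ε : ∀ i : Fin n, κ i.succ → ℤˣ, 𝔼 η : κ 0 → ℤˣ, ⨆ v, ((g v +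
            ∑ i : Fin n, ∑ t, ((ε i t : ℤ) : ℝ) * x i.succ t v) +
            ∑ t, ((η t : ℤ) : ℝ) * x 0 t v) :=
          Finset.expect_le_expect fun ε _ =>
            expect_iSup_sign_mul_le (by fun_prop) (hx 0) (hL 0)
      _ = _ := by
          rw [Finset.expect_comm]
          simp only [add_right_comm]

end Contraction

/-! ### Feature extraction before pooling -/

/-- The pooled response of a bag to a single ReLU unit with weight vector `v`. -/
noncomputable def poolRelu {d : ℕ} (B : Bag d) (v : EuclideanSpace ℝ (Fin d)) : ℝ :=
  (Finset.univ : Finset (Fin B.size)).sup' ⟨⟨0, B.size_pos⟩, Finset.mem_univ _⟩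
    fun t => relu (inner ℝ v (B.inst t))

theorem continuous_relu : Continuous relu := continuous_id.max continuous_const

theorem continuous_poolRelu {d : ℕ} (B : Bag d) : Continuous (poolRelu B) := by
  unfold poolRelu
  refine Continuous.finset_sup'_apply _ fun t _ => ?_
  exact continuous_relu.comp (by fun_prop)

theorem poolRelu_zero {d : ℕ} (B : Bag d) : poolRelu B 0 = 0 := by
  simp only [poolRelu, relu, inner_zero_left, max_self]
  exact Finset.sup'_const _ _

theorem maxPool_map_reluLayer_apply {d D : ℕ} (W : Fin D → EuclideanSpace ℝ (Fin d)) (B : Bag d)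
    (j : Fin D) : maxPool (B.map (reluLayer W)) j = poolRelu B (W j) := rfl

/-- Take `s` attaining the maximum for `v`: the same instance bounds the maximum for `v'` from
below, and ReLU is `1`-Lipschitz. -/
theorem exists_poolRelu_sub_le {d : ℕ} (B : Bag d) (v v' : EuclideanSpace ℝ (Fin d)) :
    ∃ s, poolRelu B v - poolRelu B v' ≤ |inner ℝ v (B.inst s) - inner ℝ v' (B.inst s)| := by
  obtain ⟨s, -, hs⟩ := Finset.exists_mem_eq_sup' (s := (Finset.univ : Finset (Fin B.size)))
    ⟨⟨0, B.size_pos⟩, Finset.mem_univ _⟩ fun t => relu (inner ℝ v (B.inst t))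
  refine ⟨s, ?_⟩
  have h : relu (inner ℝ v' (B.inst s)) ≤ poolRelu B v' :=
    Finset.le_sup' (fun t => relu (inner ℝ v' (B.inst t))) (Finset.mem_univ s)
  have h' : poolRelu B v = relu (inner ℝ v (B.inst s)) := hs
  calc poolRelu B v - poolRelu B v'
      ≤ relu (inner ℝ v (B.inst s)) - relu (inner ℝ v' (B.inst s)) := by linarith
    _ ≤ |relu (inner ℝ v (B.inst s)) - relu (inner ℝ v' (B.inst s))| := le_abs_self _
    _ ≤ _ := abs_max_sub_max_le_abs _ _ _

theorem exists_abs_poolRelu_sub_le {d : ℕ} (B : Bag d) (v v' : EuclideanSpace ℝ (Fin d)) :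
    ∃ s, |poolRelu B v - poolRelu B v'| ≤
      |inner ℝ v (B.inst s) - inner ℝ v' (B.inst s)| := by
  rcases abs_cases (poolRelu B v - poolRelu B v') with ⟨h, -⟩ | ⟨h, -⟩ <;> rw [h]
  · exact exists_poolRelu_sub_le B v v'
  · obtain ⟨s, hs⟩ := exists_poolRelu_sub_le B v' v
    exact ⟨s, by rw [abs_sub_comm]; linarith⟩

/-- The supremum of the sign average of the pooled responses over weight vectors of norm at most
`B₁`. -/
noncomputable def supPoolRelu {d n : ℕ} (B₁ : ℝ) (S : Fin n → Bag d) (σ : Fin n → ℤˣ) : ℝ :=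
  ⨆ v : Metric.closedBall (0 : EuclideanSpace ℝ (Fin d)) B₁,
    ∑ i, ((σ i : ℤ) : ℝ) * poolRelu (S i) v

theorem le_supPoolRelu {d n : ℕ} {B₁ : ℝ} (S : Fin n → Bag d) (σ : Fin n → ℤˣ)
    {v : EuclideanSpace ℝ (Fin d)} (hv : ‖v‖ ≤ B₁) :
    ∑ i, ((σ i : ℤ) : ℝ) * poolRelu (S i) v ≤ supPoolRelu B₁ S σ := by
  have hc : Continuous fun v : Metric.closedBall (0 : EuclideanSpace ℝ (Fin d)) B₁ =>
      ∑ i, ((σ i : ℤ) : ℝ) * poolRelu (S i) v :=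
    continuous_finsetSum _ fun i _ =>
      continuous_const.mul ((continuous_poolRelu (S i)).comp continuous_subtype_val)
  exact le_ciSup (bddAbove_range_of_continuous hc) ⟨v, mem_closedBall_zero_iff.2 hv⟩

theorem supPoolRelu_nonneg {d n : ℕ} {B₁ : ℝ} (hB₁ : 0 ≤ B₁) (S : Fin n → Bag d)
    (σ : Fin n → ℤˣ) : 0 ≤ supPoolRelu B₁ S σ := by
  have := le_supPoolRelu S σ (v := 0) (by simpa using hB₁)
  simpa [poolRelu_zero] using this

theorem expect_supPoolRelu_le {d n T : ℕ} {B₁ R : ℝ} (hB₁ : 0 ≤ B₁) (hR0 : 0 ≤ R)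
    (S : Fin n → Bag d) (hT : ∀ i, (S i).size ≤ T)
    (hR : ∀ i, ∀ t : Fin (S i).size, ‖(S i).inst t‖ ≤ R) :
    𝔼 σ, supPoolRelu B₁ S σ ≤ B₁ * (R * √((n : ℝ) * T)) := by
  have : Nonempty (Metric.closedBall (0 : EuclideanSpace ℝ (Fin d)) B₁) :=
    ⟨⟨0, by simpa using hB₁⟩⟩
  have h1 := expect_iSup_sum_sign_mul_le (κ := fun i => Fin (S i).size)
    (g := fun _ : Metric.closedBall (0 : EuclideanSpace ℝ (Fin d)) B₁ => 0)
    (φ := fun i v => poolRelu (S i) v) (x := fun i t v => inner ℝ (v : EuclideanSpace ℝ (Fin d)) ((S i).inst t))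
    continuous_const (fun i => (continuous_poolRelu (S i)).comp continuous_subtype_val)
    (fun i t => by fun_prop) (fun i v v' => exists_abs_poolRelu_sub_le (S i) v v')
  simp only [zero_add] at h1
  refine h1.trans ?_
  set h : (Σ i, Fin (S i).size) → EuclideanSpace ℝ (Fin d) := fun p => (S p.1).inst p.2 with hh
  have h2 : 𝔼 ε : ∀ i, Fin (S i).size → ℤˣ,
      (⨆ v : Metric.closedBall (0 : EuclideanSpace ℝ (Fin d)) B₁,
        ∑ i, ∑ t, ((ε i t : ℤ) : ℝ) * inner ℝ (v : EuclideanSpace ℝ (Fin d)) ((S i).inst t)) ≤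
      𝔼 ε : ∀ i, Fin (S i).size → ℤˣ,
        B₁ * ‖∑ p : (Σ i, Fin (S i).size), ((ε p.1 p.2 : ℤ) : ℝ) • h p‖ := by
    refine Finset.expect_le_expect fun ε _ => ciSup_le fun v => ?_
    have e : ∑ i, ∑ t, ((ε i t : ℤ) : ℝ) * inner ℝ (v : EuclideanSpace ℝ (Fin d)) ((S i).inst t)
        = inner ℝ (v : EuclideanSpace ℝ (Fin d))
          (∑ p : (Σ i, Fin (S i).size), ((ε p.1 p.2 : ℤ) : ℝ) • h p) := by
      rw [inner_sum, Fintype.sum_sigma]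
      simp [hh, real_inner_smul_right]
    rw [e]
    exact (real_inner_le_norm _ _).trans
      (mul_le_mul_of_nonneg_right (mem_closedBall_zero_iff.1 v.2) (norm_nonneg _))
  refine h2.trans ?_
  rw [← Finset.mul_expect]
  refine mul_le_mul_of_nonneg_left ?_ hB₁
  -- Currying turns the families of signs into one sign vector indexed by all instances.
  have h3 : 𝔼 ε : ∀ i, Fin (S i).size → ℤˣ,
      ‖∑ p : (Σ i, Fin (S i).size), ((ε p.1 p.2 : ℤ) : ℝ) • h p‖ =
      𝔼 ε : (Σ i, Fin (S i).size) → ℤˣ, ‖∑ p, ((ε p : ℤ) : ℝ) • h p‖ :=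
    (Fintype.expect_equiv (Equiv.piCurry fun i (_ : Fin (S i).size) => ℤˣ) _ _
      fun _ => rfl).symm
  rw [h3]
  refine (expect_norm_sum_sign_smul_le h).trans ?_
  refine Real.sqrt_le_iff.2 ⟨by positivity, ?_⟩
  rw [mul_pow, Real.sq_sqrt (by positivity), Fintype.sum_sigma]
  calc ∑ i, ∑ t : Fin (S i).size, ‖h ⟨i, t⟩‖ ^ 2
      ≤ ∑ i : Fin n, ∑ _t : Fin (S i).size, R ^ 2 :=
        Finset.sum_le_sum fun i _ => Finset.sum_le_sum fun t _ =>
          pow_le_pow_left₀ (norm_nonneg _) (hR i t) 2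
    _ ≤ ∑ _i : Fin n, T * R ^ 2 := Finset.sum_le_sum fun i _ => by
        simp only [Finset.sum_const, Finset.card_univ, Fintype.card_fin, nsmul_eq_mul]
        exact mul_le_mul_of_nonneg_right (by exact_mod_cast hT i) (by positivity)
    _ = R ^ 2 * (n * T) := by simp; ring

theorem norm_le_sqrt_mul_of_abs_le {D : ℕ} {u : EuclideanSpace ℝ (Fin D)} {M : ℝ} (hM : 0 ≤ M)
    (h : ∀ j, |u j| ≤ M) : ‖u‖ ≤ √D * M := by
  rw [EuclideanSpace.norm_eq]
  refine Real.sqrt_le_iff.2 ⟨by positivity, ?_⟩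
  rw [mul_pow, Real.sq_sqrt (by positivity)]
  calc ∑ j, ‖u j‖ ^ 2 ≤ ∑ _j : Fin D, M ^ 2 :=
        Finset.sum_le_sum fun j _ => pow_le_pow_left₀ (norm_nonneg _) (h j) 2
    _ = _ := by simp

/-- The suprema for `σ` and `-σ` are both nonnegative (take `v = 0`), so their sum dominates the
absolute value of every coordinate. -/
theorem signCorrelation_featModel_le {d D n : ℕ} {B₁ B₂ : ℝ} (hB₁ : 0 ≤ B₁)
    (S : Fin n → Bag d) (σ : Fin n → ℤˣ) {W : Fin D → EuclideanSpace ℝ (Fin d)}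
    {w : EuclideanSpace ℝ (Fin D)} (hW : ∀ j, ‖W j‖ ≤ B₁) (hw : ‖w‖ ≤ B₂) :
    signCorrelation S σ (featModel W w) ≤
      1 / (n : ℝ) * (B₂ * (√D * (supPoolRelu B₁ S σ + supPoolRelu B₁ S (-σ)))) := by
  unfold signCorrelation
  refine mul_le_mul_of_nonneg_left ?_ (by positivity)
  set u : EuclideanSpace ℝ (Fin D) :=
    ∑ i, ((σ i : ℤ) : ℝ) • maxPool ((S i).map (reluLayer W)) with hu
  have e : ∑ i, ((σ i : ℤ) : ℝ) * featModel W w (S i) = inner ℝ w u := by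
    simp [hu, inner_sum, real_inner_smul_right, featModel]
  have h0 := supPoolRelu_nonneg hB₁ S σ
  have h0' := supPoolRelu_nonneg hB₁ S (-σ)
  have hun : ‖u‖ ≤ √D * (supPoolRelu B₁ S σ + supPoolRelu B₁ S (-σ)) := by
    refine norm_le_sqrt_mul_of_abs_le (by positivity) fun j => ?_
    have huj : u j = ∑ i, ((σ i : ℤ) : ℝ) * poolRelu (S i) (W j) := by
      simp [hu, maxPool_map_reluLayer_apply]
    have h1 := le_supPoolRelu S σ (hW j)
    have h2 := le_supPoolRelu S (-σ) (hW j)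
    simp only [Pi.neg_apply, Units.val_neg, Int.cast_neg, neg_mul, Finset.sum_neg_distrib] at h2
    rw [huj, abs_le]
    constructor <;> linarith
  rw [e]
  exact (real_inner_le_norm _ _).trans
    (mul_le_mul hw hun (norm_nonneg _) ((norm_nonneg w).trans hw))

theorem rademacherFinite_featClass {d D n : ℕ} {B₁ B₂ : ℝ} (hB₁ : 0 ≤ B₁) (S : Fin n → Bag d) :
    RademacherFinite (featClass d D B₁ B₂) S := by
  rintro σ
  refine ⟨1 / (n : ℝ) * (B₂ * (√D * (supPoolRelu B₁ S σ + supPoolRelu B₁ S (-σ)))), ?_⟩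
  rintro _ ⟨_, ⟨W, w, hW, hw, rfl⟩, rfl⟩
  exact signCorrelation_featModel_le hB₁ S σ hW hw

/-- The bound for feature extraction before pooling, without the factor `√2`. -/
theorem empiricalRademacher_featClass_le {d D n T : ℕ} (hn : 0 < n) {B₁ B₂ R : ℝ}
    (hB₁ : 0 ≤ B₁) (hB₂ : 0 ≤ B₂) (hR0 : 0 ≤ R) (S : Fin n → Bag d)
    (hT : ∀ i, (S i).size ≤ T) (hR : ∀ i, ∀ t : Fin (S i).size, ‖(S i).inst t‖ ≤ R) :
    empiricalRademacher (featClass d D B₁ B₂) S ≤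
      2 * R * B₁ * B₂ * √((D : ℝ) * (T : ℝ) / (n : ℝ)) := by
  have hne : (featClass d D B₁ B₂).Nonempty :=
    ⟨_, 0, 0, fun j => by simpa using hB₁, by simpa using hB₂, rfl⟩
  have hneg : 𝔼 σ, supPoolRelu B₁ S (-σ) = 𝔼 σ, supPoolRelu B₁ S σ :=
    Fintype.expect_equiv (Equiv.neg _) _ _ fun _ => rfl
  have hn' : (0 : ℝ) < n := by exact_mod_cast hn
  calc empiricalRademacher (featClass d D B₁ B₂) S
      ≤ 𝔼 σ, 1 / (n : ℝ) * (B₂ * (√D * (supPoolRelu B₁ S σ + supPoolRelu B₁ S (-σ)))) := by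
        refine Finset.expect_le_expect fun σ _ => csSup_le (hne.image _) ?_
        rintro _ ⟨_, ⟨W, w, hW, hw, rfl⟩, rfl⟩
        exact signCorrelation_featModel_le hB₁ S σ hW hw
    -- The factor `2` arises because `-σ` is distributed as `σ`.
    _ = 2 / n * B₂ * √D * 𝔼 σ, supPoolRelu B₁ S σ := by
        simp_rw [← Finset.mul_expect, Finset.expect_add_distrib, hneg]
        ring
    _ ≤ 2 / n * B₂ * √D * (B₁ * (R * √((n : ℝ) * T))) :=
        mul_le_mul_of_nonneg_left (expect_supPoolRelu_le hB₁ hR0 S hT hR) (by positivity)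
    _ = _ := by
        have hs : √(n : ℝ) * √n = n := Real.mul_self_sqrt hn'.le
        have hs0 : √(n : ℝ) ≠ 0 := (Real.sqrt_pos.2 hn').ne'
        rw [Real.sqrt_div (by positivity), Real.sqrt_mul (by positivity),
          Real.sqrt_mul (by positivity)]
        field_simp
        rw [pow_two, hs]
        ring

/-! ### Reduction of the baseline to singleton bags -/

/-- The bag whose only instance is `x`. -/
def Bag.singleton {d : ℕ} (x : EuclideanSpace ℝ (Fin d)) : Bag d where
  size := 1
  size_pos := one_pos
  inst := fun _ => x

theorem featModel_singleton {d D : ℕ} (W : Fin D → EuclideanSpace ℝ (Fin d))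
    (w : EuclideanSpace ℝ (Fin D)) (B : Bag d) :
    featModel W w (Bag.singleton (maxPool B)) = baseModel W w B := by
  unfold featModel baseModel
  congr 1

/-- On a sample, the baseline class is the feature-extraction class on the pooled instances. -/
theorem signCorrelation_image_baseClass {d D n : ℕ} (B₁ B₂ : ℝ) (S : Fin n → Bag d)
    (σ : Fin n → ℤˣ) :
    signCorrelation S σ '' baseClass d D B₁ B₂ =
      signCorrelation (fun i => Bag.singleton (maxPool (S i))) σ '' featClass d D B₁ B₂ := by
  have h : ∀ W w, signCorrelation S σ (baseModel (D := D) W w) =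
      signCorrelation (fun i => Bag.singleton (maxPool (S i))) σ (featModel W w) := fun W w => by
    simp only [signCorrelation, featModel_singleton]
  ext r
  constructor
  · rintro ⟨_, ⟨W, w, hW, hw, rfl⟩, rfl⟩
    exact ⟨_, ⟨W, w, hW, hw, rfl⟩, (h W w).symm⟩
  · rintro ⟨_, ⟨W, w, hW, hw, rfl⟩, rfl⟩
    exact ⟨_, ⟨W, w, hW, hw, rfl⟩, h W w⟩

theorem norm_maxPool_le {d : ℕ} {R : ℝ} (hR0 : 0 ≤ R) (B : Bag d) (hR : ∀ t, ‖B.inst t‖ ≤ R) :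
    ‖maxPool B‖ ≤ √d * R := by
  refine norm_le_sqrt_mul_of_abs_le hR0 fun k => ?_
  obtain ⟨s, -, hs⟩ := Finset.exists_mem_eq_sup' (s := (Finset.univ : Finset (Fin B.size)))
    ⟨⟨0, B.size_pos⟩, Finset.mem_univ _⟩ fun t => B.inst t k
  have h : maxPool B k = B.inst s k := hs
  rw [h]
  exact (PiLp.norm_apply_le (B.inst s) k).trans (hR s)

end MaxPoolMIL

theorem mainTheorem4 (d D n T : ℕ) (hn : 0 < n) (B₁ B₂ R : ℝ) (hB₁ : 0 ≤ B₁) (hB₂ : 0 ≤ B₂)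
    (S : Fin n → MaxPoolMIL.Bag d)
    (hT : ∀ i, (S i).size ≤ T)
    (hR : ∀ i, ∀ t : Fin (S i).size, ‖(S i).inst t‖ ≤ R) :
    (MaxPoolMIL.RademacherFinite (MaxPoolMIL.featClass d D B₁ B₂) S ∧
      MaxPoolMIL.empiricalRademacher (MaxPoolMIL.featClass d D B₁ B₂) S ≤
        2 * √2 * R * B₁ * B₂ * √((D : ℝ) * (T : ℝ) / (n : ℝ))) ∧
    (MaxPoolMIL.RademacherFinite (MaxPoolMIL.baseClass d D B₁ B₂) S ∧
      MaxPoolMIL.empiricalRademacher (MaxPoolMIL.baseClass d D B₁ B₂) S ≤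
        2 * R * B₁ * B₂ * √((D : ℝ) * (d : ℝ) / (n : ℝ))) := by

  -- As `0 < n` and bags are nonempty, some instance forces `0 ≤ R`.
  have hR0 : 0 ≤ R := (norm_nonneg _).trans (hR ⟨0, hn⟩ ⟨0, (S ⟨0, hn⟩).size_pos⟩)
  refine ⟨⟨MaxPoolMIL.rademacherFinite_featClass hB₁ S, ?_⟩, ?_, ?_⟩
  · refine (MaxPoolMIL.empiricalRademacher_featClass_le hn hB₁ hB₂ hR0 S hT hR).trans ?_
    have h2 : (1 : ℝ) ≤ √2 := Real.one_le_sqrt.2 one_le_two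
    gcongr
    linarith
  · intro σ
    rw [MaxPoolMIL.signCorrelation_image_baseClass]
    exact MaxPoolMIL.rademacherFinite_featClass hB₁ _ σ
  · have h := MaxPoolMIL.empiricalRademacher_featClass_le (D := D) (T := 1) hn hB₁ hB₂
      (mul_nonneg (Real.sqrt_nonneg (d : ℝ)) hR0)
      (fun i => MaxPoolMIL.Bag.singleton (MaxPoolMIL.maxPool (S i))) (fun _ => le_rfl)
      (fun i _ => MaxPoolMIL.norm_maxPool_le hR0 (S i) (hR i))
    simp only [MaxPoolMIL.empiricalRademacher, MaxPoolMIL.signCorrelation_image_baseClass] at h ⊢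
    refine h.trans_eq ?_
    rw [Nat.cast_one, mul_one, mul_div_right_comm, Real.sqrt_mul (by positivity)]
    ring
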